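/- Let $\lambda(x)=\sum_{i\ge 1}\lambda_i x^{i-1}$ and $\rho(x)=\sum_{i\ge 1}\rho_i x^{i-1}$ be a degree distribution pair (edge perspective): $\lambda_i,\rho_i\ge 0$, $\sum_i\lambda_i=\sum_i\rho_i=1$, where the degrees may be unbounded as long as $\rho'(1)=\sum_i (i-1)\rho_i$ is finite; $\lambda'(0)=\lambda_2$. Transmission takes place over a binary-input memoryless symmetric channel, and $a_{ch}$ denotes its $L$-density, i.e. the law on $[-\infty,\infty]$ of the log-likelihood ratio $\log\frac{p(Y\mid 0)}{p(Y\mid 1)}$ of the channel output $Y$ when the bit $0$ is sent. For laws $a,b$ on $[-\infty,\infty]$ let $a\circledast b$ be their convolution, and let $a\boxtimes b$ be the law of $\operatorname{sgn}(X)\operatorname{sgn}(Y)\min(|X|,|Y|)$ for independent $X\sim a$, $Y\sim b$, with $a^{\circledast 0}=\delta_0$ and $a^{\boxtimes 0}=\delta_{+\infty}$. Put $$B(a)=\int e^{-x/2}\,da(x),\qquad P_e(a)=a([-\infty,0))+\tfrac12 a(\{0\}).$$ Min-sum density evolution is defined by $a_0=a_{ch}$ and, for $t\ge 1$, $$a_t=a_{ch}\circledast\sum_j\lambda_j\Big(\sum_k\rho_k\,a_{t-1}^{\boxtimes(k-1)}\Big)^{\circledast(j-1)}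 .$$ (i) If $B(a_{ch})\,\lambda'(0)\,\rho'(1)<1$, then there is a constant $\xi=\xi(\lambda,\rho,a_{ch})>0$ such that, whenever $B(a_t)\le\xi$ for some $t\in\mathbb N$, both $B(a_{t+n})$ and $P_e(a_{t+n})$ converge to $0$ as $n\to\infty$. (ii) Conversely, if $B(a_{ch})\,\lambda'(0)\,\rho'(1)>1$, then $\liminf_{t\to\infty}P_e(a_t)>0$. -/

import Mathlib

open MeasureTheory Filter Topology Set
open scoped ENNReal

noncomputable section

/-- A degree distribution from the edge perspective, i.e. the coefficients of a power series such as
`λ(x) = ∑ λ_i x^(i-1)`. The number `coeff j` is the coefficient of `x^j`, that is, the fraction of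
edges attached to a node of degree `j + 1`. -/
structure DegreeDistribution where
  coeff : ℕ → ℝ≥0∞
  tsum_coeff : ∑' j, coeff j = 1

/-- The derivative of the series `∑ coeff j * x^j` at a point `x ≥ 0`, summed termwise. -/
def DegreeDistribution.derivAt (d : DegreeDistribution) (x : ℝ≥0∞) : ℝ≥0∞ :=
  ∑' j : ℕ, d.coeff j * (j * x ^ (j - 1))

/-- One use of a binary-input symmetric channel with output alphabet `𝒴`: `law x` is the law of the
output when the bit `x` is sent, and some measurable involution of the output alphabet exchanges
the two laws. -/
structure BMSChannel (𝒴 : Type*) [MeasurableSpace 𝒴] where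
  law : Fin 2 → Measure 𝒴
  isProbabilityMeasure_law : ∀ x, IsProbabilityMeasure (law x)
  symmetric : ∃ σ : 𝒴 → 𝒴, Measurable σ ∧ Function.Involutive σ ∧ (law 0).map σ = law 1

namespace BMSChannel

variable {𝒴 : Type*} [MeasurableSpace 𝒴]

/-- The channel log-likelihood ratio `log (p(y | 0) / p(y | 1))`, where `p(· | x)` is the density of
`law x` with respect to `law 0 + law 1`. It takes values in `[-∞, ∞]`. -/
def llr (W : BMSChannel 𝒴) (y : 𝒴) : EReal :=
  ENNReal.log ((W.law 0).rnDeriv (W.law 0 + W.law 1) y / (W.law 1).rnDeriv (W.law 0 + W.law 1) y)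

/-- The `L`-density of the channel: the law of the log-likelihood ratio when `0` is sent. -/
def lDensity (W : BMSChannel 𝒴) : Measure EReal :=
  (W.law 0).map W.llr

end BMSChannel

/-- The min-sum check node rule for two messages:
`sgn x * sgn y * min |x| |y|`. -/
def minSum (x y : EReal) : EReal :=
  (SignType.sign x : EReal) * (SignType.sign y : EReal) * ((min x.abs y.abs : ℝ≥0∞) : EReal)

/-- `a ⊠ b`: the law of the min-sum combination of independent messages with laws `a` and `b`. -/
def checkConv (a b : Measure EReal) : Measure EReal :=
  (a.prod b).map fun p => minSum p.1 p.2

/-- `a^{⊠ n}`. The empty combination is the message `+∞`, the neutral element of `minSum`. -/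
def checkPow (a : Measure EReal) : ℕ → Measure EReal
  | 0 => Measure.dirac ⊤
  | n + 1 => checkConv (checkPow a n) a

/-- `a^{⊛ n}`: the `n`-fold convolution of `a` with itself. -/
def convPow (a : Measure EReal) : ℕ → Measure EReal
  | 0 => Measure.dirac 0
  | n + 1 => Measure.conv (convPow a n) a

/-- The check node side `ρ(a) = ∑_k ρ_k a^{⊠ (k-1)}`. -/
def checkMix (rho : DegreeDistribution) (a : Measure EReal) : Measure EReal :=
  Measure.sum fun j => rho.coeff j • checkPow a j

/-- The bit node side `λ(b) = ∑_k λ_k b^{⊛ (k-1)}`. -/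
def bitMix (lam : DegreeDistribution) (b : Measure EReal) : Measure EReal :=
  Measure.sum fun j => lam.coeff j • convPow b j

/-- Min-sum density evolution: `a_0 = a_ch` and `a_{t+1} = a_ch ⊛ λ(ρ(a_t))`. -/
def densityEvolution (lam rho : DegreeDistribution) (ach : Measure EReal) : ℕ → Measure EReal
  | 0 => ach
  | t + 1 => Measure.conv ach (bitMix lam (checkMix rho (densityEvolution lam rho ach t)))

/-- The Bhattacharyya parameter `B(a) = ∫ e^{-x/2} da(x)`, in `[0, ∞]`. -/
def bhattacharyya (a : Measure EReal) : ℝ≥0∞ :=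
  ∫⁻ x, EReal.exp (-x / 2) ∂a

/-- The error probability: the mass of the negative messages plus half the mass at `0`. -/
def errorProb (a : Measure EReal) : ℝ≥0∞ :=
  a (Iio 0) + a {0} / 2

end

/-! Write `B` for the Bhattacharyya parameter. It is multiplicative under convolution and, since
`minSum x y` is never below `min x y`, at most additive under the check rule. So one round sends
`B(a_t)` to at most `B(a_ch) λ(ρ'(1) B(a_t))`, whose slope at `0` is `B(a_ch) λ'(0) ρ'(1)` when
there are no degree-one bits. A slope below `1` gives a contraction near `0`, and `B` dominates the
error probability (`exists_bhattacharyya_threshold`).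

For the converse, min-sum messages lose channel symmetry but keep a weaker property,
`PositivelyBiased`, stable under every operation. It makes the mass of `[-∞, r]` grow almost
linearly in the number of messages at a check (`le_checkPow_Iic`). Keeping only degree-two bits, one
round acts on distribution functions at least like `λ'(0) ρ'(1)`, up to a small loss, times
averaging over channel shifts. If some bounded `g` supported on `[0, ∞)` is expanded by this
operator, a small multiple of `g` stays a lower bound forever (`le_densityEvolution_Iic`), so the
mass of `[-∞, 0]` cannot vanish.

Channel symmetry says that `e^{-x/2} da_ch(x)` is even at finite values. Hence `e^{u/2}` times a
long sine arch is almost an eigenfunction of the averaging, with factor close to `B(a_ch)`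
(`sineArch_mul_le_setLIntegral`). A channel without negative values is an erasure channel, where the
indicator of `{0}` serves as `g`. -/

/-! ### Threshold events of the min-sum rule. -/

lemma minSum_of_nonneg {x y : EReal} (hx : 0 ≤ x) (hy : 0 ≤ y) : minSum x y = min x y := by
  have habs : ∀ {z : EReal}, 0 ≤ z → ((z.abs : ℝ≥0∞) : EReal) = z := by
    intro z hz
    induction z with
    | bot => simp at hz
    | top => simp
    | coe z => rw [EReal.coe_abs, abs_of_nonneg (by exact_mod_cast hz)]
  have hmin : ((min x.abs y.abs : ℝ≥0∞) : EReal) = min x y := by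
    rw [EReal.coe_ennreal_strictMono.monotone.map_min, habs hx, habs hy]
  rw [minSum, hmin]
  rcases hx.eq_or_lt with rfl | hx
  · simp [hy]
  rcases hy.eq_or_lt with rfl | hy
  · simp [hx.le]
  simp [sign_pos hx, sign_pos hy]

lemma minSum_comm (x y : EReal) : minSum x y = minSum y x := by
  rw [minSum, minSum, min_comm, mul_comm (SignType.sign x : EReal)]

lemma minSum_neg_left (x y : EReal) : minSum (-x) y = -minSum x y := by
  have : (SignType.sign (-x) : EReal) = -(SignType.sign x : EReal) := by
    rcases lt_trichotomy x 0 with h | rfl | h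
    · rw [sign_neg h, sign_pos (by simpa using h)]; simp
    · simp
    · rw [sign_pos h, sign_neg (by simpa using h)]; simp
  rw [minSum, minSum, this, EReal.abs_neg, EReal.neg_mul, EReal.neg_mul]

lemma minSum_neg_right (x y : EReal) : minSum x (-y) = -minSum x y := by
  rw [minSum_comm, minSum_neg_left, minSum_comm]

lemma minSum_of_nonneg_of_nonpos {x y : EReal} (hx : 0 ≤ x) (hy : y ≤ 0) :
    minSum x y = max (-x) y := by
  have := minSum_of_nonneg hx (EReal.neg_nonneg.2 hy)
  rw [minSum_neg_right] at this
  rw [← neg_neg (minSum x y), this, EReal.neg_strictAnti.antitone.map_min, neg_neg]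

lemma minSum_of_nonpos_of_nonneg {x y : EReal} (hx : x ≤ 0) (hy : 0 ≤ y) :
    minSum x y = max x (-y) := by
  rw [minSum_comm, minSum_of_nonneg_of_nonpos hy hx, max_comm]

lemma minSum_of_nonpos {x y : EReal} (hx : x ≤ 0) (hy : y ≤ 0) :
    minSum x y = min (-x) (-y) := by
  have := minSum_of_nonneg (EReal.neg_nonneg.2 hx) (EReal.neg_nonneg.2 hy)
  rwa [minSum_neg_right, minSum_neg_left, neg_neg] at this

/-- Exhibits the threshold event as a union of two rectangles, which a product measure can evaluate.
-/
lemma lt_minSum_iff {r x y : EReal} (hr : 0 ≤ r) :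
    r < minSum x y ↔ r < x ∧ r < y ∨ x < -r ∧ y < -r := by
  have hr' : -r ≤ 0 := by simpa using hr
  rcases le_total 0 x with hx | hx <;> rcases le_total 0 y with hy | hy
  · rw [minSum_of_nonneg hx hy, lt_min_iff]
    have := (hr'.trans hx).not_gt
    tauto
  · rw [minSum_of_nonneg_of_nonpos hx hy, lt_max_iff, EReal.lt_neg_comm]
    have h1 := (hr'.trans hx).not_gt
    have h2 := (hy.trans hr).not_gt
    tauto
  · rw [minSum_of_nonpos_of_nonneg hx hy, lt_max_iff, EReal.lt_neg_comm]
    have h1 := (hr'.trans hy).not_gt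
    have h2 := (hx.trans hr).not_gt
    tauto
  · rw [minSum_of_nonpos hx hy, lt_min_iff, EReal.lt_neg_comm, EReal.lt_neg_comm (b := y)]
    have := (hx.trans hr).not_gt
    tauto

lemma le_minSum_iff {r x y : EReal} (hr : 0 < r) :
    r ≤ minSum x y ↔ r ≤ x ∧ r ≤ y ∨ x ≤ -r ∧ y ≤ -r := by
  have hr' : -r < 0 := by simpa using hr
  rcases le_total 0 x with hx | hx <;> rcases le_total 0 y with hy | hy
  · rw [minSum_of_nonneg hx hy, le_min_iff]
    have := (hr'.trans_le hx).not_ge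
    tauto
  · rw [minSum_of_nonneg_of_nonpos hx hy, le_max_iff, EReal.le_neg]
    have h1 := (hr'.trans_le hx).not_ge
    have h2 := (hy.trans_lt hr).not_ge
    tauto
  · rw [minSum_of_nonpos_of_nonneg hx hy, le_max_iff, EReal.le_neg]
    have h1 := (hr'.trans_le hy).not_ge
    have h2 := (hx.trans_lt hr).not_ge
    tauto
  · rw [minSum_of_nonpos hx hy, le_min_iff, EReal.le_neg, EReal.le_neg (b := y)]
    have := (hx.trans_lt hr).not_ge
    tauto

lemma minSum_lt_neg_iff {r x y : EReal} (hr : 0 ≤ r) :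
    minSum x y < -r ↔ r < x ∧ y < -r ∨ x < -r ∧ r < y := by
  rw [EReal.lt_neg_comm, ← minSum_neg_right, lt_minSum_iff hr, EReal.lt_neg_comm,
    EReal.neg_lt_neg_iff]

lemma minSum_le_neg_iff {r x y : EReal} (hr : 0 < r) :
    minSum x y ≤ -r ↔ r ≤ x ∧ y ≤ -r ∨ x ≤ -r ∧ r ≤ y := by
  rw [EReal.le_neg, ← minSum_neg_right, le_minSum_iff hr, EReal.le_neg,
    EReal.neg_le_neg_iff]

lemma measurable_minSum : Measurable fun p : EReal × EReal => minSum p.1 p.2 := by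
  have hs : Measurable fun x : EReal => (SignType.sign x : EReal) := by
    have : (fun x : EReal => (SignType.sign x : EReal)) =
        fun x => if 0 < x then 1 else if x < 0 then -1 else 0 := by
      ext x
      rw [sign_apply]
      split_ifs <;> simp
    rw [this]
    exact Measurable.ite measurableSet_Ioi measurable_const
      (Measurable.ite measurableSet_Iio measurable_const measurable_const)
  have ha : Measurable EReal.abs :=
    EReal.measurable_of_measurable_real
      (ENNReal.measurable_ofReal.comp continuous_abs.measurable)
  exact ((hs.comp measurable_fst).mul (hs.comp measurable_snd)).mul
    ((ha.comp measurable_fst).min (ha.comp measurable_snd)).coe_ereal_ennreal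

/-! ### The Bhattacharyya functional under the two convolutions. -/

/-- The kernel `e^{-x/2}` of the Bhattacharyya functional. -/
noncomputable def expNegHalf (x : EReal) : ℝ≥0∞ := EReal.exp (-x / 2)

lemma expNegHalf_coe (x : ℝ) : expNegHalf x = ENNReal.ofReal (Real.exp (-x / 2)) := by
  rw [expNegHalf, ← EReal.exp_coe]
  norm_cast

@[simp] lemma expNegHalf_top : expNegHalf ⊤ = 0 := by
  rw [expNegHalf, EReal.neg_top, EReal.bot_div_of_pos_ne_top (by norm_num) (by decide), EReal.exp_bot]

@[simp] lemma expNegHalf_zero : expNegHalf 0 = 1 := by simp [expNegHalf]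

lemma antitone_expNegHalf : Antitone expNegHalf := fun _ _ h =>
  EReal.exp_monotone (EReal.div_le_div_right_of_nonneg (by norm_num) (EReal.neg_le_neg_iff.2 h))

lemma measurable_expNegHalf : Measurable expNegHalf := antitone_expNegHalf.measurable

/-- The value `⊥` has to be excluded: `⊤ + ⊥ = ⊥` has kernel `∞`, while the product of the kernels
is `0 * ∞ = 0`. This is why laws are required to have no mass at `⊥`. -/
lemma expNegHalf_add {x y : EReal} (hx : x ≠ ⊥) (hy : y ≠ ⊥) :
    expNegHalf (x + y) = expNegHalf x * expNegHalf y := by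
  induction x with
  | bot => simp at hx
  | top => simp [EReal.top_add_of_ne_bot hy]
  | coe x =>
    induction y with
    | bot => simp at hy
    | top => simp
    | coe y =>
      rw [← EReal.coe_add, expNegHalf_coe, expNegHalf_coe, expNegHalf_coe,
        ← ENNReal.ofReal_mul (Real.exp_pos _).le, ← Real.exp_add]
      congr 2
      ring

/-- In each sign pattern `minSum x y` is at least one of `x`, `y`, and the kernel is antitone. -/
lemma expNegHalf_minSum_le (x y : EReal) :
    expNegHalf (minSum x y) ≤ expNegHalf x + expNegHalf y := by
  rcases le_total 0 x with hx | hx <;> rcases le_total 0 y with hy | hy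
  · rw [minSum_of_nonneg hx hy, antitone_expNegHalf.map_min]
    exact max_le le_self_add le_add_self
  · rw [minSum_of_nonneg_of_nonpos hx hy]
    exact (antitone_expNegHalf (le_max_right _ _)).trans le_add_self
  · rw [minSum_of_nonpos_of_nonneg hx hy]
    exact (antitone_expNegHalf (le_max_left _ _)).trans le_self_add
  · rw [minSum_of_nonpos hx hy]
    refine (antitone_expNegHalf (?_ : x ≤ _)).trans le_self_add
    exact hx.trans (le_min (by simpa using hx) (by simpa using hy))

lemma bhattacharyya_eq_lintegral_expNegHalf (a : Measure EReal) :
    bhattacharyya a = ∫⁻ x, expNegHalf x ∂a := rfl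

lemma bhattacharyya_conv {a b : Measure EReal} [SFinite a] [SFinite b]
    (ha : a {⊥} = 0) (hb : b {⊥} = 0) :
    bhattacharyya (Measure.conv a b) = bhattacharyya a * bhattacharyya b := by
  have ha' : ∀ᵐ x ∂a, x ≠ ⊥ := compl_mem_ae_iff.2 ha
  have hb' : ∀ᵐ x ∂b, x ≠ ⊥ := compl_mem_ae_iff.2 hb
  simp_rw [bhattacharyya_eq_lintegral_expNegHalf]
  rw [Measure.lintegral_conv measurable_expNegHalf,
    ← lintegral_mul_const _ measurable_expNegHalf]
  refine lintegral_congr_ae (ha'.mono fun x hx => ?_)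
  simp only
  rw [← lintegral_const_mul _ measurable_expNegHalf]
  exact lintegral_congr_ae (hb'.mono fun y hy => expNegHalf_add hx hy)

lemma bhattacharyya_checkConv_le (a b : Measure EReal) [IsProbabilityMeasure a]
    [IsProbabilityMeasure b] :
    bhattacharyya (checkConv a b) ≤ bhattacharyya a + bhattacharyya b := by
  simp_rw [bhattacharyya_eq_lintegral_expNegHalf]
  rw [checkConv, lintegral_map measurable_expNegHalf measurable_minSum]
  have h : ∀ p : EReal × EReal, expNegHalf (minSum p.1 p.2) ≤ expNegHalf p.1 + expNegHalf p.2 :=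
    fun p => expNegHalf_minSum_le p.1 p.2
  have hm : Measurable fun p : EReal × EReal => expNegHalf p.1 :=
    measurable_expNegHalf.comp measurable_fst
  refine (lintegral_mono h).trans_eq ?_
  rw [lintegral_add_left hm,
    measurePreserving_fst.lintegral_comp (μ := a.prod b) measurable_expNegHalf,
    measurePreserving_snd.lintegral_comp (μ := a.prod b) measurable_expNegHalf]

lemma bhattacharyya_sum_smul (c : ℕ → ℝ≥0∞) (a : ℕ → Measure EReal) :
    bhattacharyya (Measure.sum fun j => c j • a j) = ∑' j, c j * bhattacharyya (a j) := by
  simp_rw [bhattacharyya, lintegral_sum_measure, lintegral_smul_measure, smul_eq_mul]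

lemma errorProb_le_bhattacharyya (a : Measure EReal) : errorProb a ≤ bhattacharyya a := by
  have h1 : errorProb a ≤ a (Iic 0) := by
    have hd : Iic (0 : EReal) = Iio 0 ∪ {0} := Iio_union_right.symm
    rw [hd, measure_union (by simp) (measurableSet_singleton _), errorProb]
    gcongr
    exact ENNReal.half_le_self
  refine h1.trans ?_
  rw [← lintegral_indicator_one measurableSet_Iic, bhattacharyya_eq_lintegral_expNegHalf]
  refine lintegral_mono fun x => ?_
  by_cases hx : x ∈ Iic (0 : EReal)
  · simpa [indicator_of_mem hx] using antitone_expNegHalf hx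
  · simp [hx]

lemma half_measure_Iic_le_errorProb (a : Measure EReal) : a (Iic 0) / 2 ≤ errorProb a := by
  have hd : Iic (0 : EReal) = Iio 0 ∪ {0} := Iio_union_right.symm
  rw [hd, measure_union (by simp) (measurableSet_singleton _), errorProb, ENNReal.add_div]
  gcongr
  exact ENNReal.half_le_self

/-! ### Positive bias and its stability under density evolution. -/

/-- A law of messages without mass at `-∞` under which the message stochastically dominates its
negative. -/
structure PositivelyBiased (a : Measure EReal) : Prop where
  prob : IsProbabilityMeasure a
  measure_bot : a {⊥} = 0
  measure_Iio_le : ∀ r : ℝ, a (Iio (r : EReal)) ≤ a (Ioi (-(r : EReal)))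

namespace PositivelyBiased

lemma measure_Iic_le {a : Measure EReal} (ha : PositivelyBiased a) (r : ℝ) :
    a (Iic (r : EReal)) ≤ a (Ici (-(r : EReal))) := by
  have := ha.prob
  have h := ha.measure_Iio_le (-r)
  rw [EReal.coe_neg, neg_neg, ← compl_Ici, ← compl_Iic, prob_compl_eq_one_sub measurableSet_Ici,
    prob_compl_eq_one_sub measurableSet_Iic] at h
  exact (ENNReal.sub_le_sub_iff_left prob_le_one ENNReal.one_ne_top).1 h

lemma of_nonneg {a : Measure EReal} (hp : IsProbabilityMeasure a) (h0 : a {⊥} = 0)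
    (ho : ∀ r : ℝ, 0 ≤ r → a (Iio (-(r : EReal))) ≤ a (Ioi (r : EReal)))
    (hc : ∀ r : ℝ, 0 < r → a (Iic (-(r : EReal))) ≤ a (Ici (r : EReal))) :
    PositivelyBiased a := by
  refine ⟨hp, h0, fun r => ?_⟩
  rcases le_or_gt r 0 with hr | hr
  · simpa using ho (-r) (by linarith)
  · rw [← compl_Ici, ← compl_Iic, prob_compl_eq_one_sub measurableSet_Ici,
      prob_compl_eq_one_sub measurableSet_Iic]
    exact tsub_le_tsub_left (hc r hr) _

lemma dirac {x : EReal} (hx : 0 ≤ x) : PositivelyBiased (Measure.dirac x) := by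
  refine of_nonneg inferInstance ?_ (fun r hr => ?_) (fun r hr => ?_)
  · rw [Measure.dirac_apply' _ (measurableSet_singleton _)]
    have : x ≠ ⊥ := by rintro rfl; simp at hx
    simp [this]
  · have : ¬ x < -(r : EReal) := not_lt.2 (le_trans (by simpa using hr) hx)
    rw [Measure.dirac_apply' _ measurableSet_Iio]
    simp [this]
  · have : ¬ x ≤ -(r : EReal) := not_le.2 (lt_of_lt_of_le (by simpa using hr) hx)
    rw [Measure.dirac_apply' _ measurableSet_Iic]
    simp [this]

lemma sum_smul {c : ℕ → ℝ≥0∞} (hc : ∑' j, c j = 1) {a : ℕ → Measure EReal}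
    (ha : ∀ j, PositivelyBiased (a j)) : PositivelyBiased (Measure.sum fun j => c j • a j) := by
  have := fun j => (ha j).prob
  refine ⟨⟨?_⟩, ?_, fun r => ?_⟩
  · rw [Measure.sum_apply _ MeasurableSet.univ]
    simp [hc]
  · rw [Measure.sum_apply _ (measurableSet_singleton _)]
    simp [(ha _).measure_bot]
  · rw [Measure.sum_apply _ measurableSet_Iio, Measure.sum_apply _ measurableSet_Ioi]
    refine ENNReal.tsum_le_tsum fun j => ?_
    simp only [Measure.smul_apply, smul_eq_mul]
    exact mul_le_mul_right ((ha j).measure_Iio_le r) _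

/-- The signs of the two independent summands are flipped one at a time: `x + y < s`, then `-x + y <
s`, then `-x - y < s`. Each flip conditions on the other variable. -/
lemma conv {a b : Measure EReal} (ha : PositivelyBiased a) (hb : PositivelyBiased b) :
    PositivelyBiased (Measure.conv a b) := by
  have := ha.prob
  have := hb.prob
  have ha' : ∀ᵐ x ∂a, x ≠ ⊥ := compl_mem_ae_iff.2 ha.measure_bot
  have hb' : ∀ᵐ x ∂b, x ≠ ⊥ := compl_mem_ae_iff.2 hb.measure_bot
  have hm : Measurable fun p : EReal × EReal => p.1 + p.2 := measurable_fst.add measurable_snd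
  refine ⟨Measure.isProbabilityMeasure_map hm.aemeasurable, ?_, fun s => ?_⟩
  · rw [Measure.conv, Measure.map_apply hm (measurableSet_singleton _),
      Measure.measure_prod_null (hm (measurableSet_singleton _))]
    filter_upwards [ha'] with x hx
    refine measure_mono_null (fun y hy => ?_) hb.measure_bot
    simpa [EReal.add_eq_bot_iff, hx] using hy
  · rw [Measure.conv, Measure.map_apply hm measurableSet_Iio, Measure.map_apply hm measurableSet_Ioi]
    have hmid : MeasurableSet {p : EReal × EReal | p.2 < p.1 + s} :=
      measurableSet_lt measurable_snd (measurable_fst.add_const _)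
    have h1 : (a.prod b) ((fun p : EReal × EReal => p.1 + p.2) ⁻¹' Iio (s : EReal)) ≤
        (a.prod b) {p | p.2 < p.1 + s} := by
      rw [Measure.prod_apply_symm (hm measurableSet_Iio), Measure.prod_apply_symm hmid]
      refine lintegral_mono_ae (hb'.mono fun y hy => ?_)
      induction y with
      | bot => simp at hy
      | top =>
        refine (measure_mono_null (fun x hx => ?_) ha.measure_bot).trans_le zero_le
        by_contra hx'
        simp [EReal.add_top_of_ne_bot hx'] at hx
      | coe y =>
        convert ha.measure_Iio_le (s - y) using 2
        · ext x
          simp only [mem_preimage, mem_Iio, EReal.coe_sub]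
          rw [EReal.lt_sub_iff_add_lt (by simp) (by simp)]
        · ext x
          simp only [mem_preimage, mem_ofPred_eq, mem_Ioi]
          rw [← EReal.coe_neg, neg_sub, EReal.coe_sub, EReal.sub_lt_iff (by simp) (by simp)]
    have h2 : (a.prod b) {p | p.2 < p.1 + s} ≤
        (a.prod b) ((fun p : EReal × EReal => p.1 + p.2) ⁻¹' Ioi (-(s : EReal))) := by
      rw [Measure.prod_apply (hm measurableSet_Ioi), Measure.prod_apply hmid]
      refine lintegral_mono_ae (ha'.mono fun x hx => ?_)
      induction x with
      | bot => simp at hx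
      | top =>
        refine measure_mono_ae (hb'.mono fun y hy _ => ?_)
        change -(s : EReal) < ⊤ + y
        rw [EReal.top_add_of_ne_bot hy, ← EReal.coe_neg]
        exact EReal.coe_lt_top _
      | coe x =>
        refine (hb.measure_Iio_le (x + s)).trans_eq ?_
        congr 1
        ext y
        simp only [mem_preimage, mem_Ioi]
        rw [← EReal.coe_neg, ← EReal.coe_neg, neg_add_rev, ← sub_eq_add_neg, EReal.coe_sub,
          EReal.sub_lt_iff (by simp) (by simp), add_comm (y : EReal)]
    exact h1.trans h2

/-- With `P` the high and `N` the low messages, the masses of agreeing and of disagreeing pairs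
differ by `(a P - a N) * (b P - b N)`, which is nonnegative. -/
lemma checkConv {a b : Measure EReal} (ha : PositivelyBiased a) (hb : PositivelyBiased b) :
    PositivelyBiased (checkConv a b) := by
  have := ha.prob
  have := hb.prob
  have key : ∀ P N : Set EReal, Disjoint P N → MeasurableSet P → MeasurableSet N →
      a N ≤ a P → b N ≤ b P →
      (a.prod b) (P ×ˢ N ∪ N ×ˢ P) ≤ (a.prod b) (P ×ˢ P ∪ N ×ˢ N) := by
    intro P N hPN hP hN h1 h2
    rw [measure_union (hPN.set_prod_left _ _) (hN.prod hP),
      measure_union (hPN.set_prod_left _ _) (hN.prod hN)]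
    simp_rw [Measure.prod_prod]
    obtain ⟨c, hc⟩ := exists_add_of_le h1
    obtain ⟨d, hd⟩ := exists_add_of_le h2
    rw [hc, hd]
    calc _ ≤ (a N * b N + c * b N + (a N * b N + a N * d)) + c * d := by
          refine le_of_eq_of_le ?_ le_self_add
          ring
      _ = _ := by ring
  refine of_nonneg (Measure.isProbabilityMeasure_map measurable_minSum.aemeasurable) ?_
    (fun r hr => ?_) (fun r hr => ?_)
  · rw [_root_.checkConv, Measure.map_apply measurable_minSum (measurableSet_singleton _),
      Measure.measure_prod_null (measurable_minSum (measurableSet_singleton _))]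
    have ha' : ∀ᵐ x ∂a, x ≠ ⊥ := compl_mem_ae_iff.2 ha.measure_bot
    filter_upwards [ha'] with x hx
    refine measure_mono_null (fun y hy => ?_) hb.measure_bot
    -- Writing `⊥` as `-⊤` makes this a threshold event at level `⊤`.
    have hle : minSum x y ≤ -⊤ := by
      simp only [mem_preimage, mem_singleton_iff] at hy
      simp [hy]
    rw [minSum_le_neg_iff EReal.zero_lt_top] at hle
    have hxy : x = ⊤ ∧ y = ⊥ := by simpa [hx] using hle
    exact hxy.2
  · rw [_root_.checkConv, Measure.map_apply measurable_minSum measurableSet_Iio,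
      Measure.map_apply measurable_minSum measurableSet_Ioi]
    have hr' : (0 : EReal) ≤ r := by exact_mod_cast hr
    have h : -(r : EReal) ≤ r := le_trans (by simpa using hr) hr'
    have hd : Disjoint (Ioi (r : EReal)) (Iio (-(r : EReal))) :=
      Set.disjoint_left.2 fun x hx hx' => ((mem_Iio.1 hx').trans_le h).not_gt hx
    convert key _ _ hd measurableSet_Ioi measurableSet_Iio
      (by simpa using ha.measure_Iio_le (-r)) (by simpa using hb.measure_Iio_le (-r)) using 2
    · ext p
      simp [minSum_lt_neg_iff hr']
    · ext p
      simp [lt_minSum_iff hr']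
  · rw [_root_.checkConv, Measure.map_apply measurable_minSum measurableSet_Iic,
      Measure.map_apply measurable_minSum measurableSet_Ici]
    have hr' : (0 : EReal) < r := by exact_mod_cast hr
    have h : -(r : EReal) < r := lt_trans (by simpa using hr) hr'
    have hd : Disjoint (Ici (r : EReal)) (Iic (-(r : EReal))) :=
      Set.disjoint_left.2 fun x hx hx' => ((mem_Iic.1 hx').trans_lt h).not_ge hx
    convert key _ _ hd measurableSet_Ici measurableSet_Iic
      (by simpa using ha.measure_Iic_le (-r)) (by simpa using hb.measure_Iic_le (-r)) using 2
    · ext p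
      simp only [mem_preimage, mem_Ici, minSum_le_neg_iff hr', mem_union, mem_prod, mem_Iic]
    · ext p
      simp only [mem_preimage, mem_Ici, le_minSum_iff hr', mem_union, mem_prod, mem_Iic]

lemma checkPow {a : Measure EReal} (ha : PositivelyBiased a) :
    ∀ n, PositivelyBiased (checkPow a n)
  | 0 => dirac le_top
  | n + 1 => (checkPow ha n).checkConv ha

lemma convPow {a : Measure EReal} (ha : PositivelyBiased a) : ∀ n, PositivelyBiased (convPow a n)
  | 0 => dirac le_rfl
  | n + 1 => (convPow ha n).conv ha

lemma checkMix {a : Measure EReal} (ha : PositivelyBiased a) (rho : DegreeDistribution) :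
    PositivelyBiased (checkMix rho a) :=
  sum_smul rho.tsum_coeff ha.checkPow

lemma bitMix {a : Measure EReal} (ha : PositivelyBiased a) (lam : DegreeDistribution) :
    PositivelyBiased (bitMix lam a) :=
  sum_smul lam.tsum_coeff ha.convPow

lemma densityEvolution {a : Measure EReal} (ha : PositivelyBiased a)
    (lam rho : DegreeDistribution) : ∀ t, PositivelyBiased (densityEvolution lam rho a t)
  | 0 => ha
  | t + 1 => ha.conv (((densityEvolution ha lam rho t).checkMix rho).bitMix lam)

end PositivelyBiased

/-! ### The recursion for the Bhattacharyya parameter. -/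

lemma bhattacharyya_checkPow_le {a : Measure EReal} (ha : PositivelyBiased a) (n : ℕ) :
    bhattacharyya (checkPow a n) ≤ n * bhattacharyya a := by
  have := ha.prob
  induction n with
  | zero =>
    simp [checkPow, bhattacharyya_eq_lintegral_expNegHalf, lintegral_dirac]
  | succ n ih =>
    have := (ha.checkPow n).prob
    calc bhattacharyya (checkPow a (n + 1)) ≤ bhattacharyya (checkPow a n) + bhattacharyya a :=
          bhattacharyya_checkConv_le _ _
      _ ≤ n * bhattacharyya a + bhattacharyya a := by gcongr
      _ = _ := by push_cast; ring

lemma bhattacharyya_checkMix_le {a : Measure EReal} (ha : PositivelyBiased a)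
    (rho : DegreeDistribution) :
    bhattacharyya (checkMix rho a) ≤ rho.derivAt 1 * bhattacharyya a := by
  rw [checkMix, bhattacharyya_sum_smul, DegreeDistribution.derivAt, ← ENNReal.tsum_mul_right]
  refine ENNReal.tsum_le_tsum fun j => ?_
  rw [one_pow, mul_one, mul_assoc]
  gcongr
  exact bhattacharyya_checkPow_le ha j

lemma bhattacharyya_convPow {a : Measure EReal} (ha : PositivelyBiased a) (n : ℕ) :
    bhattacharyya (convPow a n) = bhattacharyya a ^ n := by
  have := ha.prob
  induction n with
  | zero => simp [convPow, bhattacharyya_eq_lintegral_expNegHalf, lintegral_dirac]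
  | succ n ih =>
    have := (ha.convPow n).prob
    rw [convPow, bhattacharyya_conv (ha.convPow n).measure_bot ha.measure_bot, ih, pow_succ]

lemma bhattacharyya_densityEvolution_succ {a : Measure EReal} (ha : PositivelyBiased a)
    (lam rho : DegreeDistribution) (t : ℕ) :
    bhattacharyya (densityEvolution lam rho a (t + 1)) = bhattacharyya a *
      ∑' j, lam.coeff j * bhattacharyya (checkMix rho (densityEvolution lam rho a t)) ^ j := by
  have := ha.prob
  have h := (ha.densityEvolution lam rho t).checkMix rho
  have := (h.bitMix lam).prob
  rw [densityEvolution, bhattacharyya_conv ha.measure_bot (h.bitMix lam).measure_bot, bitMix,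
    bhattacharyya_sum_smul]
  simp_rw [bhattacharyya_convPow h]

lemma DegreeDistribution.derivAt_zero (d : DegreeDistribution) : d.derivAt 0 = d.coeff 1 := by
  rw [DegreeDistribution.derivAt, tsum_eq_single 1]
  · simp
  · rintro (_ | _ | j) hj
    · simp
    · simp at hj
    · simp

/-! ### Symmetry of the channel law and its consequences. -/

namespace BMSChannel

variable {𝒴 : Type*} [MeasurableSpace 𝒴] (W : BMSChannel 𝒴)

lemma measurable_llr : Measurable W.llr :=
  ENNReal.log_monotone.measurable.comp
    ((Measure.measurable_rnDeriv _ _).div (Measure.measurable_rnDeriv _ _))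

lemma isProbabilityMeasure_lDensity : IsProbabilityMeasure W.lDensity :=
  have := W.isProbabilityMeasure_law 0
  Measure.isProbabilityMeasure_map W.measurable_llr.aemeasurable

lemma lDensity_bot : W.lDensity {⊥} = 0 := by
  have := W.isProbabilityMeasure_law
  have hac : W.law 0 ≪ W.law 0 + W.law 1 := Measure.AbsolutelyContinuous.rfl.add_right _
  rw [lDensity, Measure.map_apply W.measurable_llr (measurableSet_singleton _)]
  have h1 := Measure.rnDeriv_pos hac
  have h2 := hac.ae_le (Measure.rnDeriv_ne_top (W.law 1) (W.law 0 + W.law 1))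
  have : ∀ᵐ y ∂W.law 0, W.llr y ≠ ⊥ := by
    filter_upwards [h1, h2] with y h1 h2
    simp [llr, ENNReal.div_eq_zero_iff, h1.ne', h2]
  exact compl_mem_ae_iff.1 this

/-- The symmetry of the `L`-density: `da(-x) = e^{-x} da(x)`. -/
lemma lintegral_lDensity_neg {f : EReal → ℝ≥0∞} (hf : Measurable f) (hbot : f ⊥ = 0) :
    ∫⁻ x, f (-x) ∂W.lDensity = ∫⁻ x, f x * EReal.exp (-x) ∂W.lDensity := by
  have := W.isProbabilityMeasure_law
  obtain ⟨σ, hσ, hinv, hmap⟩ := W.symmetric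
  set ν := W.law 0 + W.law 1 with hν
  have hac0 : W.law 0 ≪ ν := Measure.AbsolutelyContinuous.rfl.add_right _
  have hac1 : W.law 1 ≪ ν := Measure.AbsolutelyContinuous.rfl.add_right' _
  have hmap' : (W.law 1).map σ = W.law 0 := by
    rw [← hmap, Measure.map_map hσ hσ, hinv.comp_self, Measure.map_id]
  have hmapν : ν.map σ = ν := by
    rw [hν, Measure.map_add _ _ hσ, hmap, hmap', add_comm]
  let e : 𝒴 ≃ᵐ 𝒴 := ⟨hinv.toPerm, hσ, hσ⟩
  have he : MeasurableEmbedding σ := e.measurableEmbedding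
  -- The involution swaps the two conditional densities, hence negates the log-likelihood ratio.
  have hd0 : (fun y => (W.law 1).rnDeriv ν (σ y)) =ᵐ[ν] (W.law 0).rnDeriv ν := by
    have := he.rnDeriv_map (W.law 0) ν
    rwa [hmap, hmapν] at this
  have hd1 : (fun y => (W.law 0).rnDeriv ν (σ y)) =ᵐ[ν] (W.law 1).rnDeriv ν := by
    have := he.rnDeriv_map (W.law 1) ν
    rwa [hmap', hmapν] at this
  have hpos : ∀ᵐ y ∂ν, (W.law 0).rnDeriv ν y ≠ 0 ∨ (W.law 1).rnDeriv ν y ≠ 0 := by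
    rw [hν, ae_add_measure_iff]
    exact ⟨(Measure.rnDeriv_pos hac0).mono fun y hy => Or.inl hy.ne',
      (Measure.rnDeriv_pos hac1).mono fun y hy => Or.inr hy.ne'⟩
  have hfin0 := Measure.rnDeriv_ne_top (W.law 0) ν
  have hfin1 := Measure.rnDeriv_ne_top (W.law 1) ν
  have hllr : ∀ᵐ y ∂ν, W.llr (σ y) = -W.llr y := by
    filter_upwards [hd0, hd1, hpos, hfin0, hfin1] with y h0 h1 hp hf0 hf1
    rw [llr, llr, ← hν, h0, h1, ← ENNReal.log_inv, ENNReal.inv_div (Or.inl hf1)]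
    tauto
  have hmf : Measurable fun x : EReal => f (-x) := hf.comp measurable_neg
  have hmfe : Measurable fun x : EReal => f x * EReal.exp (-x) :=
    hf.mul (EReal.exp_monotone.measurable.comp measurable_neg)
  rw [lDensity, lintegral_map hmf W.measurable_llr, lintegral_map hmfe W.measurable_llr]
  calc ∫⁻ y, f (-W.llr y) ∂W.law 0 = ∫⁻ y, f (W.llr (σ y)) ∂W.law 0 :=
        by
        refine lintegral_congr_ae ?_
        filter_upwards [hac0.ae_le hllr] with y hy
        rw [hy]
    _ = ∫⁻ y, f (W.llr y) ∂W.law 1 := by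
        rw [← hmap]
        exact (lintegral_map (hf.comp W.measurable_llr) hσ).symm
    _ = ∫⁻ y, (W.law 1).rnDeriv ν y * f (W.llr y) ∂ν :=
        (lintegral_rnDeriv_mul hac1 (hf.comp W.measurable_llr).aemeasurable).symm
    _ = ∫⁻ y, (W.law 0).rnDeriv ν y * (f (W.llr y) * EReal.exp (-W.llr y)) ∂ν := by
        refine lintegral_congr_ae ?_
        filter_upwards [hpos, hfin0, hfin1] with y hp hf0 hf1
        -- Outputs impossible under bit `0` have ratio `⊥` and are invisible to `W.law 0`; the
        -- symmetry survives there only because `f ⊥ = 0`.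
        by_cases h0 : (W.law 0).rnDeriv ν y = 0
        · have : W.llr y = ⊥ := by simp [llr, ← hν, h0]
          simp [this, hbot]
        · have : EReal.exp (-W.llr y) = (W.law 1).rnDeriv ν y / (W.law 0).rnDeriv ν y := by
            rw [llr, ← hν, EReal.exp_neg, ENNReal.exp_log, ENNReal.inv_div (Or.inl hf1) (Or.inr h0)]
          rw [this, mul_left_comm, ENNReal.mul_div_cancel h0 hf0, mul_comm]
    _ = ∫⁻ y, f (W.llr y) * EReal.exp (-W.llr y) ∂W.law 0 :=
        lintegral_rnDeriv_mul hac0 (hmfe.comp W.measurable_llr).aemeasurable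

lemma lDensity_neg_preimage_le {s : Set EReal} (hs : MeasurableSet s) (h0 : s ⊆ Ici 0) :
    W.lDensity ((fun x => -x) ⁻¹' s) ≤ W.lDensity s := by
  rw [← lintegral_indicator_one (measurable_neg hs), ← lintegral_indicator_one hs]
  have h := W.lintegral_lDensity_neg (f := s.indicator 1) (measurable_one.indicator hs)
    (indicator_of_notMem (fun h => by simpa using h0 h) _)
  refine (h.trans_le (lintegral_mono fun x => ?_))
  by_cases hx : x ∈ s
  · have hx0 : 0 ≤ x := h0 hx
    simpa [hx] using hx0
  · simp [hx]

lemma positivelyBiased_lDensity : PositivelyBiased W.lDensity := by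
  refine .of_nonneg W.isProbabilityMeasure_lDensity W.lDensity_bot (fun r hr => ?_) fun r hr => ?_
  · convert W.lDensity_neg_preimage_le (s := Ioi (r : EReal)) measurableSet_Ioi
      (fun x hx => (show (0 : EReal) ≤ r by exact_mod_cast hr).trans (le_of_lt hx)) using 2
    ext x
    simp only [mem_Iio, mem_preimage, mem_Ioi]
    rw [EReal.lt_neg_comm]
  · convert W.lDensity_neg_preimage_le (s := Ici (r : EReal)) measurableSet_Ici
      (fun x hx => (show (0 : EReal) ≤ r by exact_mod_cast hr.le).trans hx) using 2
    ext x
    simp only [mem_Iic, mem_preimage, mem_Ici]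
    rw [EReal.le_neg]

/-- Reflecting the negative half by symmetry turns its integrand into `e^{x/2} * e^{-x} ≤ 1` on
finite `x > 0`, so each half contributes at most `1`. -/
lemma bhattacharyya_lDensity_ne_top : bhattacharyya W.lDensity ≠ ∞ := by
  have := W.isProbabilityMeasure_lDensity
  have hsplit : bhattacharyya W.lDensity ≤
      ∫⁻ x, (Ioi (0 : EReal)).indicator (fun x => expNegHalf (-x)) (-x) ∂W.lDensity
        + ∫⁻ _, 1 ∂W.lDensity := by
    rw [← lintegral_add_right _ measurable_const, bhattacharyya_eq_lintegral_expNegHalf]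
    refine lintegral_mono fun x => ?_
    rcases lt_or_ge x 0 with hx | hx
    · rw [indicator_of_mem (by simpa using hx), neg_neg]
      exact le_self_add
    · refine le_trans ?_ le_add_self
      rw [← expNegHalf_zero]
      exact antitone_expNegHalf hx
  have hbound : ∫⁻ x, (Ioi (0 : EReal)).indicator (fun x => expNegHalf (-x)) (-x) ∂W.lDensity ≤
      ∫⁻ _, 1 ∂W.lDensity := by
    have hm : Measurable fun x => expNegHalf (-x) := measurable_expNegHalf.comp measurable_neg
    rw [W.lintegral_lDensity_neg (hm.indicator measurableSet_Ioi) (by simp)]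
    refine lintegral_mono fun x => ?_
    by_cases hx : x ∈ Ioi (0 : EReal)
    · rw [indicator_of_mem hx]
      induction x with
      | bot => simp at hx
      | top => simp
      | coe x =>
        have hx0 : 0 < x := by simpa using hx
        rw [← EReal.coe_neg, expNegHalf_coe, EReal.exp_coe,
          ← ENNReal.ofReal_mul (Real.exp_pos _).le, ← Real.exp_add]
        refine ENNReal.ofReal_le_one.2 (Real.exp_le_one_iff.2 (by linarith))
    · simp [hx]
  refine ne_top_of_le_ne_top ?_ (hsplit.trans (add_le_add_left hbound _))
  simp

end BMSChannel

/-! ### Contraction below the threshold. -/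

/-- Degree-one bits only ever forward the channel message, which puts a floor under the parameter.
-/
lemma coeff_zero_mul_le_bhattacharyya_densityEvolution {a : Measure EReal}
    (ha : PositivelyBiased a) (lam rho : DegreeDistribution) (t : ℕ) :
    bhattacharyya a * lam.coeff 0 ≤ bhattacharyya (densityEvolution lam rho a t) := by
  have hle : lam.coeff 0 ≤ 1 := lam.tsum_coeff ▸ ENNReal.le_tsum 0
  cases t with
  | zero => exact mul_le_of_le_one_right' hle
  | succ t =>
    rw [bhattacharyya_densityEvolution_succ ha]
    gcongr
    refine le_trans ?_ (ENNReal.le_tsum 0)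
    simp

lemma tsum_coeff_mul_pow_le (lam : DegreeDistribution) (h0 : lam.coeff 0 = 0) {y : ℝ≥0∞}
    (hy : y ≤ 1) : ∑' j, lam.coeff j * y ^ j ≤ lam.coeff 1 * y + y ^ 2 := by
  calc ∑' j, lam.coeff j * y ^ j
      ≤ ∑' j, ((if j = 1 then lam.coeff 1 * y else 0) + lam.coeff j * y ^ 2) := by
        refine ENNReal.tsum_le_tsum fun j => ?_
        match j with
        | 0 => simp [h0]
        | 1 => simp
        | j + 2 =>
          refine le_trans ?_ le_add_self
          gcongr lam.coeff _ * ?_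
          exact pow_le_pow_right_of_le_one' hy (by omega)
    _ = lam.coeff 1 * y + y ^ 2 := by
        rw [ENNReal.tsum_add, tsum_ite_eq, ENNReal.tsum_mul_right, lam.tsum_coeff, one_mul]

theorem exists_bhattacharyya_threshold {a : Measure EReal} (ha : PositivelyBiased a)
    (hfin : bhattacharyya a ≠ ∞) (lam rho : DegreeDistribution) (hrho : rho.derivAt 1 ≠ ∞)
    (h : bhattacharyya a * lam.derivAt 0 * rho.derivAt 1 < 1) :
    ∃ ξ : NNReal, 0 < ξ ∧ ∀ t : ℕ, bhattacharyya (densityEvolution lam rho a t) ≤ (ξ : ℝ≥0∞) →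
      Tendsto (fun n => bhattacharyya (densityEvolution lam rho a (t + n))) atTop (𝓝 0) := by
  rw [lam.derivAt_zero] at h
  rcases eq_or_ne (bhattacharyya a) 0 with hzero | hne
  · have hall : ∀ t, bhattacharyya (densityEvolution lam rho a t) = 0 := by
      rintro (_ | t)
      · exact hzero
      · rw [bhattacharyya_densityEvolution_succ ha, hzero, zero_mul]
    exact ⟨1, one_pos, fun t _ => by simp [hall]⟩
  rcases eq_or_ne (lam.coeff 0) 0 with h0 | h0
  swap
  -- With degree-one bits, `ξ` is taken below the floor, so no iterate ever satisfies the
  -- hypothesis.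
  · obtain ⟨ξ, hξ0, hξ⟩ := ENNReal.lt_iff_exists_nnreal_btwn.1
      (pos_iff_ne_zero.2 (mul_ne_zero hne h0))
    exact ⟨ξ, by exact_mod_cast hξ0, fun t ht => absurd
      ((coeff_zero_mul_le_bhattacharyya_densityEvolution ha lam rho t).trans ht) (not_le.2 hξ)⟩
  have hl1 : lam.coeff 1 ≠ ∞ :=
    ne_top_of_le_ne_top ENNReal.one_ne_top (lam.tsum_coeff ▸ ENNReal.le_tsum 1)
  have hstep : ∀ ξ : ℝ≥0∞, rho.derivAt 1 * ξ ≤ 1 → ∀ t,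
      bhattacharyya (densityEvolution lam rho a t) ≤ ξ →
      bhattacharyya (densityEvolution lam rho a (t + 1)) ≤
        (bhattacharyya a * lam.coeff 1 * rho.derivAt 1
          + bhattacharyya a * rho.derivAt 1 ^ 2 * ξ) *
          bhattacharyya (densityEvolution lam rho a t) := by
    intro ξ hξ t ht
    set x := bhattacharyya (densityEvolution lam rho a t)
    have hy := bhattacharyya_checkMix_le (ha.densityEvolution lam rho t) rho
    have hDx : rho.derivAt 1 * x ≤ rho.derivAt 1 * ξ := by gcongr
    rw [bhattacharyya_densityEvolution_succ ha]
    calc _ ≤ bhattacharyya a * (lam.coeff 1 * (rho.derivAt 1 * x) + (rho.derivAt 1 * x) ^ 2) := by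
          gcongr
          refine (tsum_coeff_mul_pow_le lam h0 (hy.trans (hDx.trans hξ))).trans ?_
          gcongr
      _ ≤ bhattacharyya a * (lam.coeff 1 * (rho.derivAt 1 * x)
            + (rho.derivAt 1 * ξ) * (rho.derivAt 1 * x)) := by
          rw [sq]
          gcongr
      _ = _ := by ring
  generalize bhattacharyya a = β at *
  generalize rho.derivAt 1 = D at *
  generalize lam.coeff 1 = l at *
  lift β to NNReal using hfin
  lift D to NNReal using hrho
  lift l to NNReal using hl1
  have hc1 : ∀ᶠ ξ : NNReal in 𝓝[>] 0, β * l * D + β * D ^ 2 * ξ < 1 := by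
    refine nhdsWithin_le_nhds ((Continuous.tendsto (by fun_prop) _).eventually_lt_const ?_)
    simpa using (by exact_mod_cast h : β * l * D < 1)
  have hc2 : ∀ᶠ ξ : NNReal in 𝓝[>] 0, D * ξ < 1 := by
    refine nhdsWithin_le_nhds ((Continuous.tendsto (by fun_prop) _).eventually_lt_const ?_)
    simp
  -- The first bound makes the step a contraction; the second keeps the check-side parameter below
  -- `1`, where higher powers are dominated by the square.
  obtain ⟨ξ, ⟨hq, hD⟩, hξ⟩ := ((hc1.and hc2).and self_mem_nhdsWithin).exists
  refine ⟨ξ, hξ, fun t ht => ?_⟩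
  replace hstep := hstep ξ (by exact_mod_cast hD.le)
  set q : ℝ≥0∞ := β * l * D + β * D ^ 2 * ξ with hqdef
  have hq' : q < 1 := by rw [hqdef]; exact_mod_cast hq
  have hind : ∀ n, bhattacharyya (densityEvolution lam rho a (t + n)) ≤ q ^ n * ξ := by
    intro n
    induction n with
    | zero => simpa using ht
    | succ n ih =>
      have hle : q ^ n * ξ ≤ ξ := mul_le_of_le_one_left' (pow_le_one' hq'.le n)
      calc _ ≤ q * bhattacharyya (densityEvolution lam rho a (t + n)) :=
            hstep _ (ih.trans hle)
        _ ≤ q * (q ^ n * ξ) := by gcongr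
        _ = _ := by ring
  refine tendsto_of_tendsto_of_tendsto_of_le_of_le tendsto_const_nhds ?_ (fun _ => zero_le) hind
  simpa using ENNReal.Tendsto.mul_const (ENNReal.tendsto_pow_atTop_nhds_zero_of_lt_one hq')
    (Or.inr ENNReal.coe_ne_top)

/-! ### Growth of the distribution function at check nodes. -/

/-- The right side is `1/2 + (1 - 2u)(1 - 2w)/2`. If `p ≤ 1/2` or `p' ≤ 1/2`, bias bounds the left
side by `1/2`; otherwise `q ≤ 1 - p` and `q' ≤ 1 - p'` bound it by `1/2 + (2p - 1)(2p' - 1)/2`. -/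
lemma mul_add_mul_le_of_le_half {p q p' q' u w : ℝ} (hq : 0 ≤ q) (hqp : q ≤ p) (hpq : p + q ≤ 1)
    (hpu : p ≤ 1 - u) (hq' : 0 ≤ q') (hqp' : q' ≤ p') (hpq' : p' + q' ≤ 1) (hpw : p' ≤ 1 - w)
    (hu : u ≤ 1 / 2) (hw : w ≤ 1 / 2) : p * p' + q * q' ≤ 1 - (u + w - 2 * u * w) := by
  rcases le_total p (1 / 2) with hp | hp
  · nlinarith [mul_nonneg (sub_nonneg.2 hu) (sub_nonneg.2 hw), mul_nonneg hq' (sub_nonneg.2 hqp),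
      mul_nonneg (hq.trans hqp) (sub_nonneg.2 hpq')]
  rcases le_total p' (1 / 2) with hp' | hp'
  · nlinarith [mul_nonneg (sub_nonneg.2 hu) (sub_nonneg.2 hw), mul_nonneg hq (sub_nonneg.2 hqp'),
      mul_nonneg (hq'.trans hqp') (sub_nonneg.2 hpq)]
  · have h1 : q * q' ≤ (1 - p) * (1 - p') :=
      mul_le_mul (by linarith) (by linarith) hq' (by linarith)
    have h2 : (2 * p - 1) * (2 * p' - 1) ≤ (1 - 2 * u) * (1 - 2 * w) :=
      mul_le_mul (by linarith) (by linarith) (by linarith) (by linarith)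
    nlinarith

namespace PositivelyBiased

lemma le_checkConv_Iic {a b : Measure EReal} (ha : PositivelyBiased a) (hb : PositivelyBiased b)
    {r u w : ℝ} (hr : 0 ≤ r) (hu : u ≤ a.real (Iic (r : EReal))) (hw : w ≤ b.real (Iic (r : EReal)))
    (hu2 : u ≤ 1 / 2) (hw2 : w ≤ 1 / 2) :
    u + w - 2 * u * w ≤ (_root_.checkConv a b).real (Iic (r : EReal)) := by
  have := ha.prob
  have := hb.prob
  have := (ha.checkConv hb).prob
  have hr' : (0 : EReal) ≤ r := by exact_mod_cast hr
  have hle : -(r : EReal) ≤ r := le_trans (by simpa using hr) hr'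
  have hd : Disjoint (Ioi (r : EReal)) (Iio (-(r : EReal))) :=
    Set.disjoint_left.2 fun x hx hx' => ((mem_Iio.1 hx').trans_le hle).not_gt hx
  have hsum : (_root_.checkConv a b).real (Ioi (r : EReal)) =
      a.real (Ioi (r : EReal)) * b.real (Ioi (r : EReal)) +
        a.real (Iio (-(r : EReal))) * b.real (Iio (-(r : EReal))) := by
    have hpre : (fun p : EReal × EReal => minSum p.1 p.2) ⁻¹' Ioi (r : EReal) =
        Ioi (r : EReal) ×ˢ Ioi (r : EReal) ∪ Iio (-(r : EReal)) ×ˢ Iio (-(r : EReal)) := by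
      ext p
      simp only [mem_preimage, mem_Ioi, lt_minSum_iff hr', mem_union, mem_prod, mem_Iio]
    rw [_root_.checkConv, map_measureReal_apply measurable_minSum measurableSet_Ioi, hpre,
      measureReal_union (hd.set_prod_left _ _) (measurableSet_Iio.prod measurableSet_Iio),
      measureReal_prod_prod, measureReal_prod_prod]
  have hcompl : ∀ (c : Measure EReal) [IsProbabilityMeasure c],
      c.real (Ioi (r : EReal)) = 1 - c.real (Iic (r : EReal)) := fun c _ => by
    rw [← compl_Iic, probReal_compl_eq_one_sub measurableSet_Iic]
  have hbias : ∀ {c : Measure EReal}, PositivelyBiased c →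
      c.real (Iio (-(r : EReal))) ≤ c.real (Ioi (r : EReal)) := fun {c} hc => by
    have := hc.prob
    have h := hc.measure_Iio_le (-r)
    rw [EReal.coe_neg, neg_neg] at h
    exact ENNReal.toReal_mono (measure_ne_top _ _) h
  have htot : ∀ (c : Measure EReal) [IsProbabilityMeasure c],
      c.real (Ioi (r : EReal)) + c.real (Iio (-(r : EReal))) ≤ 1 := fun c _ => by
    rw [← measureReal_union hd measurableSet_Iio]
    exact measureReal_le_one
  have key := mul_add_mul_le_of_le_half (u := u) (w := w) measureReal_nonneg (hbias ha) (htot a)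
    (by rw [hcompl]; linarith) measureReal_nonneg (hbias hb) (htot b) (by rw [hcompl]; linarith)
    hu2 hw2
  rw [← hsum, hcompl] at key
  linarith

lemma le_checkPow_Iic {a : Measure EReal} (ha : PositivelyBiased a) {r w ε : ℝ} {M : ℕ}
    (hr : 0 ≤ r) (hw0 : 0 ≤ w) (hw : w ≤ a.real (Iic (r : EReal))) (hM : 2 * M * w ≤ ε)
    (hε : ε ≤ 1) {m : ℕ} (hm : m ≤ M) :
    m * w * (1 - ε) ≤ (_root_.checkPow a m).real (Iic (r : EReal)) := by
  induction m with
  | zero => simp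
  | succ m ih =>
    have hmM : (m + 1 : ℝ) ≤ M := by exact_mod_cast hm
    have hm0 : (0 : ℝ) ≤ m := m.cast_nonneg
    have hMw : (m + 1) * w ≤ M * w := by gcongr
    have hε0 : 0 ≤ ε := le_trans (by positivity) hM
    have hmw : 0 ≤ m * w := by positivity
    -- With `u = m * w * (1 - ε)`, the increment `w - 2uw` is then at least `w * (1 - ε)`.
    have hu : m * w * (1 - ε) ≤ ε / 2 := by nlinarith
    have h := (ha.checkPow m).le_checkConv_Iic ha hr (ih (by omega)) hw (by linarith)
      (by nlinarith)
    refine le_trans ?_ h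
    push_cast
    nlinarith

lemma le_checkMix_Iic {a : Measure EReal} (ha : PositivelyBiased a) (rho : DegreeDistribution)
    {r w ε : ℝ} {M : ℕ} (hr : 0 ≤ r) (hw0 : 0 ≤ w) (hw : w ≤ a.real (Iic (r : EReal)))
    (hM : 2 * M * w ≤ ε) (hε : ε ≤ 1) :
    (∑ j ∈ Finset.range (M + 1), rho.coeff j * j) * ENNReal.ofReal (w * (1 - ε)) ≤
      _root_.checkMix rho a (Iic (r : EReal)) := by
  rw [_root_.checkMix, Measure.sum_apply _ measurableSet_Iic, Finset.sum_mul]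
  refine le_trans (Finset.sum_le_sum fun j hj => ?_) (ENNReal.sum_le_tsum (Finset.range (M + 1)))
  have := (ha.checkPow j).prob
  have h := ha.le_checkPow_Iic hr hw0 hw hM hε (Nat.lt_succ_iff.1 (Finset.mem_range.1 hj))
  rw [Measure.smul_apply, smul_eq_mul, mul_assoc]
  gcongr
  rw [← ENNReal.ofReal_natCast, ← ENNReal.ofReal_mul j.cast_nonneg, ← mul_assoc]
  exact ENNReal.ofReal_le_of_le_toReal h

end PositivelyBiased

/-! ### Propagating a test function through density evolution. -/

/-- Discards all bits except those of degree two and all channel values outside `[-A, A]`. -/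
lemma coeff_one_mul_le_conv_bitMix_Iic {a b : Measure EReal} [SFinite a] [SFinite b]
    (lam : DegreeDistribution) (A r : ℝ) {g : ℝ → ℝ≥0∞}
    (hg : ∀ u : ℝ, g u ≤ b (Iic (u : EReal))) [SFinite (bitMix lam b)] :
    lam.coeff 1 * ∫⁻ x in Icc (-(A : EReal)) A, g (r - x.toReal) ∂a ≤
      Measure.conv a (bitMix lam b) (Iic (r : EReal)) := by
  have hm : Measurable fun p : EReal × EReal => p.1 + p.2 := measurable_fst.add measurable_snd
  have hbit : ∀ s, MeasurableSet s → lam.coeff 1 * b s ≤ bitMix lam b s := fun s hs => by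
    rw [bitMix, Measure.sum_apply _ hs]
    refine le_trans ?_ (ENNReal.le_tsum 1)
    simp [convPow]
  have hl1 : lam.coeff 1 ≠ ∞ :=
    ne_top_of_le_ne_top ENNReal.one_ne_top (lam.tsum_coeff ▸ ENNReal.le_tsum 1)
  rw [Measure.conv, Measure.map_apply hm measurableSet_Iic,
    Measure.prod_apply (hm measurableSet_Iic), ← lintegral_const_mul' _ _ hl1]
  refine (setLIntegral_mono' measurableSet_Icc fun x hx => ?_).trans (setLIntegral_le_lintegral _ _)
  refine le_trans ?_ (hbit _ (measurable_prodMk_left (hm measurableSet_Iic)))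
  gcongr lam.coeff 1 * ?_
  refine (hg _).trans (measure_mono fun y hy => ?_)
  induction x with
  | bot =>
    have := hx.1
    rw [← EReal.coe_neg] at this
    simp at this
  | top =>
    have := hx.2
    simp at this
  | coe x =>
    simp only [EReal.toReal_coe, EReal.coe_sub, mem_Iic] at hy
    have := EReal.add_le_of_le_sub hy
    simpa [add_comm] using this

/-- If a bounded test function `g` supported on `[0, ∞)` is multiplied by at least `θ` under
averaging along the channel, and `θ` exceeds the inverse gain of the linearised recursion, then the
distribution functions of all iterates of density evolution stay above a fixed multiple of `g`. -/
theorem le_densityEvolution_Iic {a : Measure EReal} (ha : PositivelyBiased a)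
    (lam rho : DegreeDistribution) {A ε κ : ℝ} {M : ℕ} {θ : ℝ≥0∞} {g : ℝ → ℝ}
    (hg0 : ∀ u, 0 ≤ g u) (hg1 : ∀ u, g u ≤ 1) (hgneg : ∀ u < 0, g u = 0)
    (hθ : ∀ r, θ * ENNReal.ofReal (g r) ≤
      ∫⁻ x in Icc (-(A : EReal)) A, ENNReal.ofReal (g (r - x.toReal)) ∂a)
    (hε1 : ε ≤ 1)
    (hgain : 1 ≤ lam.coeff 1 * (∑ j ∈ Finset.range (M + 1), rho.coeff j * j) *
      ENNReal.ofReal (1 - ε) * θ)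
    (hκ0 : 0 ≤ κ) (hκM : 2 * M * κ ≤ ε) (hκ : κ ≤ a.real (Iic 0)) (t : ℕ) :
    (∀ r : ℝ, 0 ≤ r → κ * g r ≤ (densityEvolution lam rho a t).real (Iic (r : EReal))) ∧
    lam.coeff 1 * ((∑ j ∈ Finset.range (M + 1), rho.coeff j * j) *
      ENNReal.ofReal (κ * (1 - ε)) *
        ∫⁻ x in Icc (-(A : EReal)) A, ENNReal.ofReal (g (0 - x.toReal)) ∂a) ≤
      densityEvolution lam rho a (t + 1) (Iic 0) := by
  have := ha.prob
  set R := ∑ j ∈ Finset.range (M + 1), rho.coeff j * j with hR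
  have hRtop : R ≠ ∞ := ENNReal.sum_ne_top.2 fun j _ => ENNReal.mul_ne_top
    (ne_top_of_le_ne_top ENNReal.one_ne_top (rho.tsum_coeff ▸ ENNReal.le_tsum j))
    (ENNReal.natCast_ne_top j)
  have hstep : ∀ t, (∀ r : ℝ, 0 ≤ r →
      κ * g r ≤ (densityEvolution lam rho a t).real (Iic (r : EReal))) → ∀ r : ℝ,
      lam.coeff 1 * (R * ENNReal.ofReal (κ * (1 - ε)) *
        ∫⁻ x in Icc (-(A : EReal)) A, ENNReal.ofReal (g (r - x.toReal)) ∂a) ≤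
      densityEvolution lam rho a (t + 1) (Iic (r : EReal)) := by
    intro t ht r
    have hd := ha.densityEvolution lam rho t
    have := (hd.checkMix rho).prob
    have := ((hd.checkMix rho).bitMix lam).prob
    rw [← lintegral_const_mul' _ _ (ENNReal.mul_ne_top hRtop ENNReal.ofReal_ne_top)]
    refine coeff_one_mul_le_conv_bitMix_Iic lam A r (b := checkMix rho _)
      (g := fun u => R * ENNReal.ofReal (κ * (1 - ε)) * ENNReal.ofReal (g u)) fun u => ?_
    rcases lt_or_ge u 0 with hu | hu
    -- The check-node estimate holds only at nonnegative thresholds, hence the support condition on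
    -- `g`.
    · simp [hgneg u hu]
    · have h1 : 2 * M * (κ * g u) ≤ ε := by
        have : 2 * M * κ * g u ≤ 2 * M * κ := mul_le_of_le_one_right (by positivity) (hg1 u)
        linarith
      refine le_of_eq_of_le ?_ (hd.le_checkMix_Iic rho hu (mul_nonneg hκ0 (hg0 u)) (ht u hu) h1 hε1)
      rw [mul_assoc, ← ENNReal.ofReal_mul (mul_nonneg hκ0 (by linarith)), ← hR]
      congr 2
      ring
  have hall : ∀ t, ∀ r : ℝ, 0 ≤ r →
      κ * g r ≤ (densityEvolution lam rho a t).real (Iic (r : EReal)) := by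
    intro t
    induction t with
    | zero =>
      intro r hr
      refine (mul_le_of_le_one_right hκ0 (hg1 r)).trans (hκ.trans ?_)
      exact measureReal_mono (Iic_subset_Iic.2 (by exact_mod_cast hr))
    | succ t ih =>
      intro r hr
      have := (ha.densityEvolution lam rho (t + 1)).prob
      refine (ENNReal.ofReal_le_iff_le_toReal (measure_ne_top _ _)).1
        (le_trans ?_ (hstep t ih r))
      calc ENNReal.ofReal (κ * g r)
          ≤ (lam.coeff 1 * R * ENNReal.ofReal (1 - ε) * θ) * ENNReal.ofReal (κ * g r) :=
            le_mul_of_one_le_left' hgain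
        _ = lam.coeff 1 * (R * ENNReal.ofReal (κ * (1 - ε)) * (θ * ENNReal.ofReal (g r))) := by
            rw [ENNReal.ofReal_mul hκ0, ENNReal.ofReal_mul hκ0]
            ring
        _ ≤ _ := by
            gcongr
            exact hθ r
  exact ⟨hall t, by simpa using hstep t (hall t) 0⟩

theorem liminf_errorProb_densityEvolution_pos {a : Measure EReal} (ha : PositivelyBiased a)
    (lam rho : DegreeDistribution) {A ε : ℝ} {M : ℕ} {θ : ℝ≥0∞} {g : ℝ → ℝ}
    (hg0 : ∀ u, 0 ≤ g u) (hg1 : ∀ u, g u ≤ 1) (hgneg : ∀ u < 0, g u = 0)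
    (hθ : ∀ r, θ * ENNReal.ofReal (g r) ≤
      ∫⁻ x in Icc (-(A : EReal)) A, ENNReal.ofReal (g (r - x.toReal)) ∂a)
    (hε0 : 0 < ε) (hε1 : ε < 1)
    (hgain : 1 ≤ lam.coeff 1 * (∑ j ∈ Finset.range (M + 1), rho.coeff j * j) *
      ENNReal.ofReal (1 - ε) * θ)
    (hpos : ∫⁻ x in Icc (-(A : EReal)) A, ENNReal.ofReal (g (0 - x.toReal)) ∂a ≠ 0) :
    0 < liminf (fun t => errorProb (densityEvolution lam rho a t)) atTop := by
  have := ha.prob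
  -- If the channel were almost surely positive, `g (-x)` would vanish almost surely, against
  -- `hpos`.
  have hinit : 0 < a.real (Iic 0) := by
    refine ENNReal.toReal_pos (fun h => hpos ?_) (measure_ne_top _ _)
    refine (setLIntegral_congr_fun_ae measurableSet_Icc ?_).trans lintegral_zero
    have h' : ∀ᵐ x ∂a, x ∉ Iic (0 : EReal) := compl_mem_ae_iff.2 h
    filter_upwards [h'] with x hx hxA
    induction x with
    | bot => simp at hx
    | top => exact absurd hxA.2 (by simp)
    | coe x =>
      have hx0 : 0 < x := by simpa using hx
      simp [hgneg (-x) (by linarith)]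
  -- The denominator `2 * M + 1` also covers `M = 0`.
  obtain ⟨κ, hκ0, hκ1, hκ2⟩ : ∃ κ : ℝ, 0 < κ ∧ κ ≤ a.real (Iic 0) ∧ κ ≤ ε / (2 * M + 1) :=
    ⟨min (a.real (Iic 0)) (ε / (2 * M + 1)), lt_min hinit (by positivity), min_le_left _ _,
      min_le_right _ _⟩
  have hκM : 2 * M * κ ≤ ε := by
    rw [le_div_iff₀ (by positivity)] at hκ2
    nlinarith
  have hne : lam.coeff 1 * (∑ j ∈ Finset.range (M + 1), rho.coeff j * j) ≠ 0 := by
    intro h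
    simp [h] at hgain
  set c := lam.coeff 1 * ((∑ j ∈ Finset.range (M + 1), rho.coeff j * j) *
      ENNReal.ofReal (κ * (1 - ε)) *
        ∫⁻ x in Icc (-(A : EReal)) A, ENNReal.ofReal (g (0 - x.toReal)) ∂a) with hc
  have hcpos : 0 < c / 2 := by
    refine ENNReal.half_pos (mul_ne_zero (left_ne_zero_of_mul hne) (mul_ne_zero
      (mul_ne_zero (right_ne_zero_of_mul hne) ?_) hpos))
    exact (ENNReal.ofReal_pos.2 (mul_pos hκ0 (by linarith))).ne'
  refine hcpos.trans_le (le_liminf_of_le (by isBoundedDefault) ?_)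
  filter_upwards [eventually_ge_atTop 1] with t ht
  obtain ⟨t, rfl⟩ := Nat.exists_eq_add_of_le' ht
  have h := (le_densityEvolution_Iic ha lam rho hg0 hg1 hgneg hθ hε1.le hgain hκ0.le hκM hκ1 t).2
  exact (ENNReal.div_le_div_right h 2).trans (half_measure_Iic_le_errorProb _)

/-! ### The sine arch as an approximate eigenfunction. -/

/-- One arch of the sine function, on `[0, K]`. -/
noncomputable def sineArch (K : ℝ) : ℝ → ℝ :=
  (Icc 0 K).indicator fun u => Real.sin (Real.pi * u / K)

lemma sineArch_nonneg {K : ℝ} (hK : 0 < K) (u : ℝ) : 0 ≤ sineArch K u := by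
  refine indicator_nonneg (fun u hu => Real.sin_nonneg_of_nonneg_of_le_pi ?_ ?_) u
  · exact div_nonneg (mul_nonneg Real.pi_pos.le hu.1) hK.le
  · rw [div_le_iff₀ hK]
    exact mul_le_mul_of_nonneg_left hu.2 Real.pi_pos.le

lemma sineArch_le_one (K u : ℝ) : sineArch K u ≤ 1 :=
  indicator_le' (fun _ _ => Real.sin_le_one _) (fun _ _ => zero_le_one) u

lemma measurable_sineArch (K : ℝ) : Measurable (sineArch K) :=
  Measurable.indicator (by fun_prop) measurableSet_Icc

/-- On the half-periods adjacent to the arch the sine is nonpositive, so cutting it off only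
increases it. -/
lemma sin_le_sineArch {K u : ℝ} (hK : 0 < K) (h1 : -K ≤ u) (h2 : u ≤ 2 * K) :
    Real.sin (Real.pi * u / K) ≤ sineArch K u := by
  by_cases hu : u ∈ Icc 0 K
  · rw [sineArch, indicator_of_mem hu]
  rw [sineArch, indicator_of_notMem hu]
  have hpi := Real.pi_pos
  rcases lt_or_ge u 0 with h | h
  · refine Real.sin_nonpos_of_nonpos_of_neg_pi_le ?_ ?_
    · exact div_nonpos_of_nonpos_of_nonneg (by nlinarith) hK.le
    · rw [le_div_iff₀ hK]
      nlinarith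
  · have hKu : K < u := not_le.1 fun h' => hu ⟨h, h'⟩
    rw [← neg_neg (Real.sin _), ← Real.sin_sub_pi]
    refine neg_nonpos.2 (Real.sin_nonneg_of_nonneg_of_le_pi ?_ ?_)
    · rw [sub_nonneg, le_div_iff₀ hK]
      nlinarith
    · rw [sub_le_iff_le_add, div_le_iff₀ hK]
      nlinarith

/-- The identity `sin (α - β) + sin (α + β) = 2 cos β sin α`, with `r ± l` staying in `[-K, 2 * K]`,
where the cut-off arch dominates the sine. -/
lemma two_mul_cos_mul_sineArch_le {A K r l : ℝ} (hK : 0 < K) (hAK : 2 * A ≤ K) (hl : |l| ≤ A) :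
    2 * (Real.cos (Real.pi * A / K) * sineArch K r) ≤ sineArch K (r - l) + sineArch K (r + l) := by
  by_cases hr : r ∈ Icc 0 K
  swap
  · rw [sineArch, indicator_of_notMem hr, mul_zero, mul_zero]
    exact add_nonneg (sineArch_nonneg hK _) (sineArch_nonneg hK _)
  obtain ⟨hl1, hl2⟩ := abs_le.1 hl
  have hA : 0 ≤ A := (abs_nonneg l).trans hl
  have h1 := sin_le_sineArch (u := r - l) hK (by linarith [hr.1]) (by linarith [hr.2])
  have h2 := sin_le_sineArch (u := r + l) hK (by linarith [hr.1]) (by linarith [hr.2])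
  have hcos : Real.cos (Real.pi * A / K) ≤ Real.cos (Real.pi * l / K) := by
    rw [← Real.cos_abs (Real.pi * l / K), abs_div, abs_mul, abs_of_pos Real.pi_pos, abs_of_pos hK]
    refine Real.cos_le_cos_of_nonneg_of_le_pi (by positivity) ?_ ?_
    · rw [div_le_iff₀ hK]
      nlinarith [Real.pi_pos]
    · have := Real.pi_pos
      gcongr
  have hsum : Real.sin (Real.pi * (r - l) / K) + Real.sin (Real.pi * (r + l) / K) =
      2 * (Real.cos (Real.pi * l / K) * Real.sin (Real.pi * r / K)) := by
    rw [mul_sub, mul_add, sub_div, add_div, Real.sin_sub, Real.sin_add]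
    ring
  have hsin : sineArch K r = Real.sin (Real.pi * r / K) := indicator_of_mem hr _
  have hmul := mul_le_mul_of_nonneg_right hcos (sineArch_nonneg hK r)
  rw [hsin] at hmul ⊢
  linarith

lemma neg_mem_Icc_neg_iff {A : ℝ} {x : EReal} :
    -x ∈ Icc (-(A : EReal)) A ↔ x ∈ Icc (-(A : EReal)) A := by
  rw [mem_Icc, mem_Icc, EReal.neg_le_neg_iff, EReal.neg_le, and_comm]

lemma exists_coe_of_mem_Icc {A : ℝ} {x : EReal} (hx : x ∈ Icc (-(A : EReal)) A) :
    ∃ l : ℝ, x = l ∧ |l| ≤ A := by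
  induction x with
  | bot =>
    have := hx.1
    rw [← EReal.coe_neg] at this
    simp at this
  | top => exact absurd hx.2 (by simp)
  | coe l =>
    rw [← EReal.coe_neg] at hx
    exact ⟨l, rfl, abs_le.2 ⟨by exact_mod_cast hx.1, by exact_mod_cast hx.2⟩⟩

namespace BMSChannel

variable {𝒴 : Type*} [MeasurableSpace 𝒴] (W : BMSChannel 𝒴)

/-- The tilt by `e^{-x/2}` splits the symmetry factor `e^{-x}` equally between `x` and `-x`, leaving
an even measure. -/
lemma setLIntegral_expNegHalf_mul_neg (A : ℝ) {F : EReal → ℝ≥0∞} (hF : Measurable F) :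
    ∫⁻ x in Icc (-(A : EReal)) A, expNegHalf x * F (-x) ∂W.lDensity =
      ∫⁻ x in Icc (-(A : EReal)) A, expNegHalf x * F x ∂W.lDensity := by
  rw [← lintegral_indicator measurableSet_Icc, ← lintegral_indicator measurableSet_Icc]
  have hm : Measurable fun x => expNegHalf (-x) * F x :=
    (measurable_expNegHalf.comp measurable_neg).mul hF
  have h := W.lintegral_lDensity_neg (hm.indicator (measurableSet_Icc (a := -(A : EReal)) (b := A)))
    (indicator_of_notMem (fun h => by
      obtain ⟨l, hl, -⟩ := exists_coe_of_mem_Icc h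
      simp at hl) _)
  refine Eq.trans (lintegral_congr fun x => ?_) (h.trans (lintegral_congr fun x => ?_))
  · by_cases hx : x ∈ Icc (-(A : EReal)) A
    · rw [indicator_of_mem hx, indicator_of_mem (neg_mem_Icc_neg_iff.2 hx), neg_neg]
    · rw [indicator_of_notMem hx, indicator_of_notMem (neg_mem_Icc_neg_iff.not.2 hx)]
  · by_cases hx : x ∈ Icc (-(A : EReal)) A
    · rw [indicator_of_mem hx, indicator_of_mem hx]
      obtain ⟨l, rfl, -⟩ := exists_coe_of_mem_Icc hx
      rw [mul_right_comm, ← EReal.coe_neg, expNegHalf_coe, expNegHalf_coe, EReal.exp_coe,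
        ← ENNReal.ofReal_mul (Real.exp_pos _).le, ← Real.exp_add]
      ring_nf
    · rw [indicator_of_notMem hx, indicator_of_notMem hx, zero_mul]

lemma sineArch_mul_le_setLIntegral {A K : ℝ} (hK : 0 < K) (hAK : 2 * A ≤ K) (r : ℝ) :
    (ENNReal.ofReal (Real.cos (Real.pi * A / K)) *
      ∫⁻ x in Icc (-(A : EReal)) A, expNegHalf x ∂W.lDensity) * ENNReal.ofReal (sineArch K r) ≤
    ∫⁻ x in Icc (-(A : EReal)) A,
      expNegHalf x * ENNReal.ofReal (sineArch K (r - x.toReal)) ∂W.lDensity := by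
  have hF : Measurable fun x : EReal => ENNReal.ofReal (sineArch K (r - x.toReal)) :=
    ((measurable_sineArch K).comp (measurable_const.sub measurable_ereal_toReal)).ennreal_ofReal
  -- After doubling, one copy of the integral is reflected, so that the shifts `x` and `-x` appear
  -- together.
  refine (ENNReal.mul_le_mul_iff_right two_ne_zero ENNReal.ofNat_ne_top).1 ?_
  rw [two_mul (∫⁻ _ in _, _ ∂_)]
  nth_rw 2 [← W.setLIntegral_expNegHalf_mul_neg A hF]
  have hm : Measurable fun x : EReal => expNegHalf x * ENNReal.ofReal (sineArch K (r - x.toReal)) :=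
    measurable_expNegHalf.mul hF
  rw [← lintegral_add_left hm,
    show ∀ p q s : ℝ≥0∞, 2 * (p * q * s) = q * (2 * (p * s)) by intros; ring,
    ← lintegral_mul_const _ measurable_expNegHalf]
  refine setLIntegral_mono' measurableSet_Icc fun x hx => ?_
  obtain ⟨l, rfl, hl⟩ := exists_coe_of_mem_Icc hx
  rw [← mul_add]
  gcongr
  rw [← EReal.coe_neg, EReal.toReal_coe, EReal.toReal_coe, sub_neg_eq_add,
    ← ENNReal.ofReal_add (sineArch_nonneg hK _) (sineArch_nonneg hK _),
    ← ENNReal.ofReal_mul' (sineArch_nonneg hK _), ← ENNReal.ofReal_ofNat 2,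
    ← ENNReal.ofReal_mul zero_le_two]
  exact ENNReal.ofReal_le_ofReal (two_mul_cos_mul_sineArch_le hK hAK hl)

lemma tendsto_setLIntegral_expNegHalf :
    Tendsto (fun n : ℕ => ∫⁻ x in Icc (-((n : ℝ) : EReal)) (n : ℝ), expNegHalf x ∂W.lDensity)
      atTop (𝓝 (bhattacharyya W.lDensity)) := by
  have hmono : Monotone fun n : ℕ => Icc (-((n : ℝ) : EReal)) (n : ℝ) := fun m n h => by
    have : ((m : ℝ) : EReal) ≤ (n : ℝ) := by exact_mod_cast h
    exact Icc_subset_Icc (EReal.neg_le_neg_iff.2 this) this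
  have h := tendsto_measure_iUnion_atTop (μ := W.lDensity.withDensity expNegHalf) hmono
  have hU : W.lDensity.withDensity expNegHalf (⋃ n : ℕ, Icc (-((n : ℝ) : EReal)) (n : ℝ)) =
      bhattacharyya W.lDensity := by
    have hmeas : MeasurableSet (⋃ n : ℕ, Icc (-((n : ℝ) : EReal)) (n : ℝ)) :=
      MeasurableSet.iUnion fun _ => measurableSet_Icc
    rw [withDensity_apply _ hmeas, ← lintegral_indicator hmeas,
      bhattacharyya_eq_lintegral_expNegHalf]
    have hbot : ∀ᵐ x ∂W.lDensity, x ≠ ⊥ := compl_mem_ae_iff.2 W.lDensity_bot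
    refine lintegral_congr_ae (hbot.mono fun x hx => ?_)
    induction x with
    | bot => simp at hx
    | top => simp
    | coe x =>
      refine indicator_of_mem (mem_iUnion.2 ?_) _
      obtain ⟨n, hn⟩ := exists_nat_ge |x|
      obtain ⟨h1, h2⟩ := abs_le.1 hn
      exact ⟨n, by exact_mod_cast h1, by exact_mod_cast h2⟩
  rw [hU] at h
  simpa only [Function.comp_def, withDensity_apply _ measurableSet_Icc] using h

/-- By symmetry `e^{-x}` integrates to `0` over `x > 0`, which leaves only `⊤` there: an erasure
channel. -/
lemma ae_eq_zero_or_top (h : W.lDensity (Iio 0) = 0) : ∀ᵐ x ∂W.lDensity, x = 0 ∨ x = ⊤ := by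
  have hsym := W.lintegral_lDensity_neg (f := (Ioi (0 : EReal)).indicator 1)
    (measurable_one.indicator measurableSet_Ioi) (by simp)
  have hl : ∫⁻ x, (Ioi (0 : EReal)).indicator 1 (-x) ∂W.lDensity = 0 := by
    rw [← h, ← lintegral_indicator_one measurableSet_Iio]
    refine lintegral_congr fun x => ?_
    simp [indicator_apply]
  rw [hl] at hsym
  have hm : Measurable fun x : EReal => (Ioi (0 : EReal)).indicator (1 : EReal → ℝ≥0∞) x
      * EReal.exp (-x) :=
    (measurable_one.indicator measurableSet_Ioi).mul
      (EReal.exp_monotone.measurable.comp measurable_neg)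
  have h1 := (lintegral_eq_zero_iff hm).1 hsym.symm
  have h2 : ∀ᵐ x ∂W.lDensity, x ∉ Iio (0 : EReal) := compl_mem_ae_iff.2 h
  filter_upwards [h1, h2] with x h1 h2
  by_contra! hx
  have hpos : 0 < x := lt_of_le_of_ne (not_lt.1 h2) hx.1.symm
  simp [hpos, hx.2] at h1

end BMSChannel

/-! ### Choice of parameters and conclusion. -/

lemma DegreeDistribution.tendsto_sum_coeff_mul (d : DegreeDistribution) :
    Tendsto (fun n : ℕ => ∑ j ∈ Finset.range (n + 1), d.coeff j * j) atTop (𝓝 (d.derivAt 1)) := by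
  have h := (ENNReal.tendsto_nat_tsum fun j => d.coeff j * (j * 1 ^ (j - 1))).comp
    (tendsto_add_atTop_nat 1)
  simpa [DegreeDistribution.derivAt, Function.comp_def] using h

lemma exists_le_mul_ofReal_mul_ofReal_cos {P : ℝ≥0∞} (hP : 1 < P) (A : ℝ) :
    ∃ ε K : ℝ, 0 < ε ∧ ε < 1 ∧ 0 < K ∧ 2 * A < K ∧
      1 ≤ P * (ENNReal.ofReal (1 - ε) * ENNReal.ofReal (Real.cos (Real.pi * A / K))) := by
  have hlim : Tendsto (fun ε : ℝ => P * (ENNReal.ofReal (1 - ε) *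
      ENNReal.ofReal (Real.cos (Real.pi * A * ε)))) (𝓝[>] 0) (𝓝 P) := by
    have hc : Tendsto (fun ε : ℝ => ENNReal.ofReal (1 - ε) *
        ENNReal.ofReal (Real.cos (Real.pi * A * ε))) (𝓝[>] 0) (𝓝 1) := by
      have h1 : Tendsto (fun ε : ℝ => ENNReal.ofReal (1 - ε)) (𝓝 0) (𝓝 1) := by
        have : Continuous fun ε : ℝ => ENNReal.ofReal (1 - ε) :=
          ENNReal.continuous_ofReal.comp (by fun_prop)
        simpa using this.tendsto 0
      have h2 : Tendsto (fun ε : ℝ => ENNReal.ofReal (Real.cos (Real.pi * A * ε))) (𝓝 0) (𝓝 1) := by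
        have : Continuous fun ε : ℝ => ENNReal.ofReal (Real.cos (Real.pi * A * ε)) :=
          ENNReal.continuous_ofReal.comp (by fun_prop)
        simpa using this.tendsto 0
      simpa using (ENNReal.Tendsto.mul h1 (by simp) h2 (by simp)).mono_left nhdsWithin_le_nhds
    simpa using ENNReal.Tendsto.const_mul hc (Or.inl one_ne_zero)
  have hA : ∀ᶠ ε : ℝ in 𝓝[>] 0, 2 * A * ε < 1 := by
    refine nhdsWithin_le_nhds ((Continuous.tendsto (by fun_prop) _).eventually_lt_const ?_)
    simp
  have h1 : ∀ᶠ ε : ℝ in 𝓝[>] 0, ε < 1 := nhdsWithin_le_nhds (eventually_lt_nhds one_pos)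
  obtain ⟨ε, ⟨⟨hlt, hA⟩, h1⟩, hε⟩ :=
    (((hlim.eventually_const_lt hP).and hA).and h1 |>.and self_mem_nhdsWithin).exists
  have hε' : 0 < ε := hε
  -- One parameter controls both losses: the arch length is `K = 1 / ε`.
  refine ⟨ε, ε⁻¹, hε', h1, inv_pos.2 hε', ?_, ?_⟩
  · rwa [← one_div, lt_div_iff₀ hε']
  · rw [div_inv_eq_mul]
    exact hlt.le

theorem BMSChannel.liminf_errorProb_pos {𝒴 : Type*} [MeasurableSpace 𝒴] (W : BMSChannel 𝒴)
    (lam rho : DegreeDistribution) (hrho : rho.derivAt 1 ≠ ∞)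
    (h : 1 < bhattacharyya W.lDensity * lam.derivAt 0 * rho.derivAt 1) :
    0 < liminf (fun t => errorProb (densityEvolution lam rho W.lDensity t)) atTop := by
  rw [lam.derivAt_zero] at h
  have hl1 : lam.coeff 1 ≠ ∞ :=
    ne_top_of_le_ne_top ENNReal.one_ne_top (lam.tsum_coeff ▸ ENNReal.le_tsum 1)
  have hlim : Tendsto (fun n : ℕ => (∫⁻ x in Icc (-((n : ℝ) : EReal)) (n : ℝ),
      expNegHalf x ∂W.lDensity) * lam.coeff 1 *
      ∑ j ∈ Finset.range (n + 1), rho.coeff j * j) atTop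
      (𝓝 (bhattacharyya W.lDensity * lam.coeff 1 * rho.derivAt 1)) :=
    ENNReal.Tendsto.mul (ENNReal.Tendsto.mul_const W.tendsto_setLIntegral_expNegHalf (Or.inr hl1))
      (Or.inr hrho) rho.tendsto_sum_coeff_mul
      (Or.inr (ENNReal.mul_ne_top W.bhattacharyya_lDensity_ne_top hl1))
  have hev := hlim.eventually_const_lt h
  -- The arch vanishes at `0`, so a test function built from it detects errors at level `0` only
  -- through negative channel values; an erasure channel needs a separate `g`.
  rcases eq_or_ne (W.lDensity (Iio 0)) 0 with hz | hz
  · obtain ⟨n, hn⟩ := hev.exists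
    -- With `A = 0` the cosine is `1`: only the loss `1 - ε` is needed here.
    obtain ⟨ε, K, hε0, hε1, -, -, hP⟩ := exists_le_mul_ofReal_mul_ofReal_cos hn 0
    have hae := W.ae_eq_zero_or_top hz
    have hθ : ∀ r, (∫⁻ x in Icc (-((n : ℝ) : EReal)) (n : ℝ), expNegHalf x ∂W.lDensity) *
        ENNReal.ofReal (({0} : Set ℝ).indicator 1 r) ≤ ∫⁻ x in Icc (-((n : ℝ) : EReal)) (n : ℝ),
        ENNReal.ofReal (({0} : Set ℝ).indicator 1 (r - x.toReal)) ∂W.lDensity := fun r => by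
      rw [← lintegral_mul_const _ measurable_expNegHalf]
      refine setLIntegral_mono_ae' measurableSet_Icc (hae.mono fun x hx _ => ?_)
      rcases hx with rfl | rfl <;> simp
    refine liminf_errorProb_densityEvolution_pos W.positivelyBiased_lDensity lam rho (M := n)
      (fun u => indicator_nonneg (fun _ _ => zero_le_one) u)
      (fun u => indicator_le' (fun _ _ => le_rfl) (fun _ _ => zero_le_one) u)
      (fun u hu => indicator_of_notMem (by simpa using hu.ne) _) hθ hε0 hε1 ?_ ?_
    · refine hP.trans_eq ?_
      simp only [mul_zero, zero_div, Real.cos_zero, ENNReal.ofReal_one, mul_one]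
      ring
    · refine (lt_of_lt_of_le ?_ (hθ 0)).ne'
      simp only [mem_singleton_iff, indicator_of_mem, Pi.one_apply, ENNReal.ofReal_one, mul_one]
      refine pos_iff_ne_zero.2 fun h0 => ?_
      rw [h0, zero_mul, zero_mul] at hn
      exact not_lt_zero hn
  · have hmono : Monotone fun n : ℕ => Ico (-((n : ℝ) : EReal)) 0 := fun m n h => by
      have : ((m : ℝ) : EReal) ≤ (n : ℝ) := by exact_mod_cast h
      exact Ico_subset_Ico_left (EReal.neg_le_neg_iff.2 this)
    have hU : 0 < W.lDensity (⋃ n : ℕ, Ico (-((n : ℝ) : EReal)) 0) := by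
      refine pos_iff_ne_zero.2 fun h0 => hz (measure_mono_null (t := {⊥} ∪ _) (fun x hx => ?_)
        (measure_union_null W.lDensity_bot h0))
      induction x with
      | bot => simp
      | top => simp at hx
      | coe x =>
        obtain ⟨n, hn⟩ := exists_nat_ge (-x)
        exact Or.inr (mem_iUnion.2 ⟨n, by exact_mod_cast neg_le.1 hn, hx⟩)
    obtain ⟨n, hn, hneg⟩ :=
      (hev.and ((tendsto_measure_iUnion_atTop hmono).eventually_const_lt hU)).exists
    obtain ⟨ε, K, hε0, hε1, hK, hAK, hP⟩ := exists_le_mul_ofReal_mul_ofReal_cos hn n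
    -- The factor `e^{u/2}` absorbs the tilt, as `e^{r/2} e^{-x/2} = e^{(r-x)/2}`; `e^{-K/2}`
    -- normalises `g ≤ 1` on `[0, K]`.
    set g : ℝ → ℝ := fun u => Real.exp ((u - K) / 2) * sineArch K u with hg
    have hmg : Measurable fun x : EReal => ENNReal.ofReal (g (0 - x.toReal)) := by
      have : Measurable g := Measurable.mul (by fun_prop) (measurable_sineArch K)
      exact (this.comp (measurable_const.sub measurable_ereal_toReal)).ennreal_ofReal
    refine liminf_errorProb_densityEvolution_pos W.positivelyBiased_lDensity lam rho (M := n)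
      (A := n) (g := g) (θ := ENNReal.ofReal (Real.cos (Real.pi * n / K)) *
        ∫⁻ x in Icc (-((n : ℝ) : EReal)) (n : ℝ), expNegHalf x ∂W.lDensity)
      (fun u => mul_nonneg (Real.exp_pos _).le (sineArch_nonneg hK u)) (fun u => ?_)
      (fun u hu => ?_) (fun r => ?_) hε0 hε1 (hP.trans_eq (by ring)) ?_
    · by_cases hu : u ∈ Icc 0 K
      · exact mul_le_one₀ (Real.exp_le_one_iff.2 (by linarith [hu.2])) (sineArch_nonneg hK u)
          (sineArch_le_one K u)
      · simp [hg, sineArch, hu]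
    · simp [hg, sineArch, hu.not_ge]
    · rw [hg, ENNReal.ofReal_mul (Real.exp_pos _).le, mul_left_comm]
      refine (mul_le_mul_right (W.sineArch_mul_le_setLIntegral hK hAK.le r) _).trans ?_
      rw [← lintegral_const_mul' _ _ ENNReal.ofReal_ne_top]
      refine setLIntegral_mono' measurableSet_Icc fun x hx => ?_
      obtain ⟨l, rfl, -⟩ := exists_coe_of_mem_Icc hx
      rw [expNegHalf_coe, EReal.toReal_coe, ENNReal.ofReal_mul (Real.exp_pos _).le, ← mul_assoc,
        ← ENNReal.ofReal_mul (Real.exp_pos _).le, ← Real.exp_add]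
      refine le_of_eq ?_
      ring_nf
    · refine ((setLIntegral_pos_iff hmg).2 (hneg.trans_le (measure_mono fun x hx => ?_))).ne'
      have hx' : x ∈ Icc (-((n : ℝ) : EReal)) (n : ℝ) :=
        ⟨hx.1, hx.2.le.trans (by exact_mod_cast n.cast_nonneg)⟩
      refine ⟨?_, hx'⟩
      obtain ⟨l, rfl, hl⟩ := exists_coe_of_mem_Icc hx'
      have hl0 : l < 0 := by simpa using hx.2
      have hln : -l ≤ n := (neg_le_abs l).trans hl
      -- Since `2 * n < K`, the point `-l` lies strictly inside the arch, where the sine is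
      -- positive.
      have hmem : -l ∈ Icc 0 K := ⟨by linarith, by linarith [n.cast_nonneg (α := ℝ)]⟩
      simp only [Function.mem_support, EReal.toReal_coe, zero_sub]
      refine (ENNReal.ofReal_pos.2 (mul_pos (Real.exp_pos _) ?_)).ne'
      rw [sineArch, indicator_of_mem hmem]
      have hpi := Real.pi_pos
      refine Real.sin_pos_of_pos_of_lt_pi (div_pos (by nlinarith) hK) ?_
      rw [div_lt_iff₀ hK]
      nlinarith [n.cast_nonneg (α := ℝ)]

theorem lemma1 {𝒴 : Type*} [MeasurableSpace 𝒴] (W : BMSChannel 𝒴)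
    (lam rho : DegreeDistribution) (hrho : rho.derivAt 1 ≠ ∞) :
    (bhattacharyya W.lDensity * lam.derivAt 0 * rho.derivAt 1 < 1 →
      ∃ ξ : NNReal, 0 < ξ ∧ ∀ t : ℕ,
        bhattacharyya (densityEvolution lam rho W.lDensity t) ≤ (ξ : ℝ≥0∞) →
          Tendsto (fun n => bhattacharyya (densityEvolution lam rho W.lDensity (t + n)))
            atTop (𝓝 0) ∧
          Tendsto (fun n => errorProb (densityEvolution lam rho W.lDensity (t + n)))
            atTop (𝓝 0)) ∧
    (1 < bhattacharyya W.lDensity * lam.derivAt 0 * rho.derivAt 1 →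
      0 < liminf (fun t => errorProb (densityEvolution lam rho W.lDensity t)) atTop) := by
  refine ⟨fun h => ?_, W.liminf_errorProb_pos lam rho hrho⟩
  obtain ⟨ξ, hξ, hconv⟩ := exists_bhattacharyya_threshold W.positivelyBiased_lDensity
    W.bhattacharyya_lDensity_ne_top lam rho hrho h
  exact ⟨ξ, hξ, fun t ht => ⟨hconv t ht, tendsto_of_tendsto_of_tendsto_of_le_of_le
    tendsto_const_nhds (hconv t ht) (fun _ => zero_le)
    fun n => errorProb_le_bhattacharyya _⟩⟩
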